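/- Let $n\ge 0$ and $d\ge 2$ be integers. For $i,j\in\{1,\dots,n\}$, $i\ne j$, put $$m_{ij}:=2d\,x_i^{2d-1}x_j-d\,(x_i^{2d-1}x_j+x_ix_j^{2d-1}),$$ so that $m_{ji}=-m_{ij}$, and let $(W_1)_{\mathbb C}\subset\mathbb C[x_1,\dots,x_n]$ be the complex vector space with basis $m_{ij}$, $1\le i<j\le n$. Let $B(n)\subset O(n)$ be the group of signed permutation matrices; it acts on $(W_1)_{\mathbb C}$ by $g\cdot f=f\circ g^{-1}$, and on polynomial and rational functions on $(W_1)_{\mathbb C}$ by $(g\cdot r)(v)=r(g^{-1}v)$. Let $c_{ij}$ ($i<j$) be the dual basis of the $m_{ij}$, put $c_{ji}:=-c_{ij}$ and $u_i:=\sum_{j\neq i}c_{ij}^2$. Then the field of rational invariants $\mathbb C((W_1)_{\mathbb C})^{B(n)}$ is generated, as a field extension of $\mathbb C$, by the polynomials $$p_l:=\sum_{i<j}c_{ij}^{2l}\quad\Big(1\le l\le\tbinom n2\Big),\qquad q_l:=\sum_{i=1}^n u_i^l\quad(2\le l\le n),$$ $$z:=\sum_{i<j<k}(u_i-u_j)(u_j-u_k)(u_k-u_i)\,c_{ij}c_{jk}c_{ki}.$$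 Moreover, these polynomials separate general $B(n)$-orbits: there is a nonempty Zariski-open set $U\subset (W_1)_{\mathbb C}$ such that any $v,v'\in U$ on which all the $p_l$, all the $q_l$ and $z$ take equal values lie in the same $B(n)$-orbit. -/

import Mathlib

namespace SignedPermInvariants

open MvPolynomial

/-! ### Polynomial and rational functions on a complex vector space -/

section Functions

variable (W : Type*) [AddCommGroup W] [Module ℂ W]

/-- The algebra `ℂ[W]` of polynomial functions on `W`: the algebra of functions `W → ℂ` generated
by the linear forms on `W`. -/
def polyFun : Subalgebra ℂ (W → ℂ) :=
  Algebra.adjoin ℂ (Set.range fun φ : Module.Dual ℂ W => (φ : W → ℂ))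

variable {W}

/-- A linear form, as a polynomial function. -/
def linForm (φ : Module.Dual ℂ W) : polyFun W :=
  ⟨φ, Algebra.subset_adjoin ⟨φ, rfl⟩⟩

/-- A polynomial function restricts to a polynomial in one variable on every line. -/
theorem polyFun_line (p : polyFun W) (v w : W) :
    ∃ P : Polynomial ℂ, ∀ t : ℂ, p.1 (v + t • w) = P.eval t := by
  obtain ⟨p, hp⟩ := p
  induction hp using Algebra.adjoin_induction with
  | mem f hf =>
    obtain ⟨φ, rfl⟩ := hf
    exact ⟨Polynomial.C (φ v) + Polynomial.X * Polynomial.C (φ w), fun t => by simp; ring⟩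
  | algebraMap r => exact ⟨Polynomial.C r, fun t => by simp⟩
  | add f g _ _ hf hg =>
    obtain ⟨P, hP⟩ := hf
    obtain ⟨Q, hQ⟩ := hg
    refine ⟨P + Q, fun t => ?_⟩
    simp only [Polynomial.eval_add, ← hP, ← hQ]
    rfl
  | mul f g _ _ hf hg =>
    obtain ⟨P, hP⟩ := hf
    obtain ⟨Q, hQ⟩ := hg
    refine ⟨P * Q, fun t => ?_⟩
    simp only [Polynomial.eval_mul, ← hP, ← hQ]
    rfl

instance : NoZeroDivisors (polyFun W) where
  eq_zero_or_eq_zero_of_mul_eq_zero := by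
    intro p q h
    by_contra! hne
    obtain ⟨hp, hq⟩ := hne
    have hp' : ∃ v, p.1 v ≠ 0 := by
      by_contra! h0
      exact hp (Subtype.ext (funext h0))
    have hq' : ∃ v, q.1 v ≠ 0 := by
      by_contra! h0
      exact hq (Subtype.ext (funext h0))
    obtain ⟨v, hv⟩ := hp'
    obtain ⟨w, hw⟩ := hq'
    obtain ⟨P, hP⟩ := polyFun_line p v (w - v)
    obtain ⟨Q, hQ⟩ := polyFun_line q v (w - v)
    have hPQ : P * Q = 0 := by
      refine Polynomial.funext fun t => ?_
      rw [Polynomial.eval_mul, ← hP, ← hQ]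
      simpa using congrFun (congrArg Subtype.val h) (v + t • (w - v))
    rcases mul_eq_zero.1 hPQ with h0 | h0
    · have := hP 0
      simp [h0] at this
      exact hv this
    · have := hQ 1
      simp [h0] at this
      exact hw this

instance : IsDomain (polyFun W) := NoZeroDivisors.to_isDomain _

variable (W)

/-- The field `ℂ(W)` of rational functions on `W`, the fraction field of `ℂ[W]`. -/
abbrev RatFun : Type _ := FractionRing (polyFun W)

variable {W} {G : Type*} [Group G] (ρ : Representation ℂ G W)

theorem polyFun_comp_mem (A : W →ₗ[ℂ] W) (p : polyFun W) : (fun v => p.1 (A v)) ∈ polyFun W := by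
  obtain ⟨p, hp⟩ := p
  induction hp using Algebra.adjoin_induction with
  | mem f hf =>
    obtain ⟨φ, rfl⟩ := hf
    exact Algebra.subset_adjoin ⟨φ.comp A, rfl⟩
  | algebraMap r => exact (polyFun W).algebraMap_mem r
  | add f g _ _ hf hg => exact (polyFun W).add_mem hf hg
  | mul f g _ _ hf hg => exact (polyFun W).mul_mem hf hg

/-- The induced action on polynomial functions, `(g · p)(v) = p (g⁻¹ · v)`. -/
def polyAct (g : G) : polyFun W ≃ₐ[ℂ] polyFun W where
  toFun p := ⟨fun v => p.1 (ρ g⁻¹ v), polyFun_comp_mem (ρ g⁻¹) p⟩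
  invFun p := ⟨fun v => p.1 (ρ g v), polyFun_comp_mem (ρ g) p⟩
  left_inv p := Subtype.ext (funext fun v => by simp)
  right_inv p := Subtype.ext (funext fun v => by simp)
  map_mul' _ _ := rfl
  map_add' _ _ := rfl
  commutes' _ := rfl

/-- The induced action on rational functions, `g · (p / q) = (g · p) / (g · q)`. -/
noncomputable def ratAct (g : G) : RatFun W ≃ₐ[ℂ] RatFun W :=
  IsFractionRing.algEquivOfAlgEquiv (polyAct ρ g)

/-- The field `ℂ(W)^G` of rational invariants. -/
noncomputable def rationalInvariants : IntermediateField ℂ (RatFun W) where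
  carrier := {r | ∀ g : G, ratAct ρ g r = r}
  mul_mem' ha hb g := (map_mul (ratAct ρ g) _ _).trans (congrArg₂ _ (ha g) (hb g))
  add_mem' ha hb g := (map_add (ratAct ρ g) _ _).trans (congrArg₂ _ (ha g) (hb g))
  algebraMap_mem' r g := (ratAct ρ g).commutes r
  inv_mem' a ha g := by rw [map_inv₀, ha g]

/-- A set `S` of polynomial functions separates general orbits: on a nonempty Zariski-open set,
two points on which all members of `S` agree lie in one orbit. -/
def SeparatesGeneralOrbits (S : Set (polyFun W)) : Prop :=
  ∃ f : polyFun W, f ≠ 0 ∧ ∀ v v' : W, f.1 v ≠ 0 → f.1 v' ≠ 0 →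
    (∀ p ∈ S, p.1 v = p.1 v') → ∃ g : G, ρ g v = v'

end Functions

/-! ### The action of the signed permutation group on polynomials -/

/-- The action of `O(n)` on polynomials with complex coefficients, `(g · f)(x) = f (g⁻¹ x)`. -/
noncomputable def polyRep (n : ℕ) :
    Representation ℂ (Matrix.orthogonalGroup (Fin n) ℝ) (MvPolynomial (Fin n) ℂ) where
  toFun g := (aeval fun i => ∑ j, C (((g⁻¹).1 i j : ℝ) : ℂ) * X j :
    MvPolynomial (Fin n) ℂ →ₐ[ℂ] MvPolynomial (Fin n) ℂ).toLinearMap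
  map_one' := by
    have : (aeval fun i => ∑ j, C ((((1 : Matrix.orthogonalGroup (Fin n) ℝ)⁻¹).1 i j : ℝ) : ℂ) * X j
        : MvPolynomial (Fin n) ℂ →ₐ[ℂ] MvPolynomial (Fin n) ℂ) = AlgHom.id ℂ _ := by
      ext1 i
      simp [Matrix.one_apply, apply_ite]
    rw [this]
    rfl
  map_mul' g h := by
    have : (aeval fun i => ∑ j, C ((((g * h)⁻¹).1 i j : ℝ) : ℂ) * X j
        : MvPolynomial (Fin n) ℂ →ₐ[ℂ] MvPolynomial (Fin n) ℂ) =
        (aeval fun i => ∑ j, C (((g⁻¹).1 i j : ℝ) : ℂ) * X j).comp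
          (aeval fun i => ∑ j, C (((h⁻¹).1 i j : ℝ) : ℂ) * X j) := by
      ext1 i
      have hm : ∀ k, ((g * h)⁻¹).1 i k = ∑ j, (h⁻¹).1 i j * (g⁻¹).1 j k := by
        intro k
        rw [mul_inv_rev]
        exact Matrix.mul_apply
      simp only [aeval_X, AlgHom.comp_apply, map_sum, map_mul, algHom_C, hm,
        Complex.ofReal_sum, Complex.ofReal_mul, Finset.sum_mul, Finset.mul_sum]
      rw [Finset.sum_comm]
      simp [mul_assoc]
    rw [this]
    rfl

/-- `g` is the signed permutation matrix `e_j ↦ τ_{σ(j)} e_{σ(j)}`. -/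
def IsSignedPerm {n : ℕ} (g : Matrix (Fin n) (Fin n) ℝ) (τ : Fin n → ℤˣ)
    (σ : Equiv.Perm (Fin n)) : Prop :=
  ∀ i j, g i j = if i = σ j then ((τ i : ℤ) : ℝ) else 0

/-- The group `B(n) ⊆ O(n)` of signed permutation matrices. -/
def signedPermGroup (n : ℕ) : Subgroup (Matrix.orthogonalGroup (Fin n) ℝ) where
  carrier := {g | ∃ τ σ, IsSignedPerm g.1 τ σ}
  one_mem' := ⟨1, 1, fun i j => by simp [Matrix.one_apply]⟩
  mul_mem' := by
    rintro g h ⟨τ, σ, hg⟩ ⟨τ', σ', hh⟩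
    refine ⟨fun i => τ i * τ' (σ⁻¹ i), σ * σ', fun i j => ?_⟩
    have : (g * h).1 i j = ∑ k, g.1 i k * h.1 k j := Matrix.mul_apply
    rw [this, Finset.sum_eq_single (σ' j)]
    · rw [hg, hh]
      by_cases hi : i = σ (σ' j)
      · simp [hi]
      · simp [hi]
    · intro k _ hk
      rw [hh, if_neg hk, mul_zero]
    · simp
  inv_mem' := by
    rintro g ⟨τ, σ, hg⟩
    refine ⟨fun i => τ (σ i), σ⁻¹, fun i j => ?_⟩
    have : (g⁻¹).1 i j = g.1 j i := rfl
    rw [this, hg]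
    by_cases hj : j = σ i
    · simp [hj]
    · have hi : ¬ i = σ⁻¹ j := fun h => hj (by simp [h])
      rw [if_neg hj, if_neg hi]

/-! ### The space `(W₁)_ℂ` and its coordinates -/

/-- The form `m_{ij} = (2d choose μ) x^μ - d (x_i^{2d-1} x_j + x_i x_j^{2d-1})` for the exponent
`μ = (2d-1) ε_i + ε_j`, whose multinomial coefficient is `2d`. -/
noncomputable def m (n d : ℕ) (i j : Fin n) : MvPolynomial (Fin n) ℂ :=
  C (2 * d : ℂ) * (X i ^ (2 * d - 1) * X j)
    - C (d : ℂ) * (X i ^ (2 * d - 1) * X j + X i * X j ^ (2 * d - 1))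

/-- The pairs `i < j` of indices. -/
abbrev Pairs (n : ℕ) : Type := {e : Fin n × Fin n // e.1 < e.2}

/-- The complex vector space `(W₁)_ℂ` spanned by the forms `m_{ij}`, `i < j`. -/
noncomputable def W₁ (n d : ℕ) : Submodule ℂ (MvPolynomial (Fin n) ℂ) :=
  Submodule.span ℂ (Set.range fun e : Pairs n => m n d e.1.1 e.1.2)

theorem m_eq (n d : ℕ) (i j : Fin n) :
    m n d i j = C (d : ℂ) * (X i ^ (2 * d - 1) * X j - X i * X j ^ (2 * d - 1)) := by
  rw [m, C_mul, show (C (2 : ℂ) : MvPolynomial (Fin n) ℂ) = 2 from map_ofNat _ 2]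
  ring

theorem m_swap (n d : ℕ) (i j : Fin n) : m n d j i = -m n d i j := by
  rw [m_eq, m_eq]
  ring

theorem m_mem (n d : ℕ) (i j : Fin n) : m n d i j ∈ W₁ n d := by
  rcases lt_trichotomy i j with h | rfl | h
  · exact Submodule.subset_span ⟨⟨(i, j), h⟩, rfl⟩
  · have : m n d i i = 0 := by
      rw [m_eq]
      ring
    rw [this]
    exact zero_mem _
  · rw [m_swap]
    exact neg_mem (Submodule.subset_span ⟨⟨(j, i), h⟩, rfl⟩)

theorem polyRep_X {n : ℕ} {g : Matrix.orthogonalGroup (Fin n) ℝ} {τ : Fin n → ℤˣ}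
    {σ : Equiv.Perm (Fin n)} (hg : IsSignedPerm g.1 τ σ) (i : Fin n) :
    ∑ j, C (((g⁻¹).1 i j : ℝ) : ℂ) * X j = (C ((τ (σ i) : ℤ) : ℂ) * X (σ i) :
      MvPolynomial (Fin n) ℂ) := by
  have : ∀ j, (g⁻¹).1 i j = g.1 j i := fun _ => rfl
  simp only [this]
  rw [Finset.sum_eq_single (σ i)]
  · simp [hg (σ i) i]
  · intro k _ hk
    simp [hg k i, hk]
  · simp

/-- Signed permutations permute the forms `m_{ij}` up to sign. -/
theorem polyRep_m {n d : ℕ} (hd : d ≠ 0) {g : Matrix.orthogonalGroup (Fin n) ℝ} {τ : Fin n → ℤˣ}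
    {σ : Equiv.Perm (Fin n)} (hg : IsSignedPerm g.1 τ σ) (i j : Fin n) :
    polyRep n g (m n d i j) =
      (((τ (σ i) * τ (σ j) : ℤˣ) : ℤ) : ℂ) • m n d (σ i) (σ j) := by
  have key : ∀ k : Fin n, ((τ k : ℤ) : ℂ) ^ (2 * d - 1) = ((τ k : ℤ) : ℂ) := by
    intro k
    have h1 : ((τ k : ℤ) : ℂ) ^ 2 = 1 := by
      rcases Int.units_eq_one_or (τ k) with h | h <;> simp [h]
    obtain ⟨e, rfl⟩ := Nat.exists_eq_succ_of_ne_zero hd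
    rw [show 2 * e.succ - 1 = 2 * e + 1 by omega, pow_succ, pow_mul, h1, one_pow, one_mul]
  change aeval _ (m n d i j) = _
  rw [m_eq, m_eq]
  simp only [map_mul, map_sub, map_pow, aeval_X, algHom_C, polyRep_X hg, mul_pow, ← C_pow, key]
  rw [smul_eq_C_mul]
  simp only [algebraMap_eq, Units.val_mul, Int.cast_mul, C_mul]
  ring

theorem W₁_le_comap (n d : ℕ) (g : signedPermGroup n) :
    W₁ n d ≤ (W₁ n d).comap (((polyRep n).comp (signedPermGroup n).subtype) g) := by
  rcases eq_or_ne d 0 with rfl | hd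
  · have : W₁ n 0 = ⊥ := by
      rw [W₁, Submodule.span_eq_bot]
      rintro _ ⟨e, rfl⟩
      simp [m]
    rw [this]
    exact bot_le
  rw [W₁, Submodule.span_le]
  rintro _ ⟨e, rfl⟩
  obtain ⟨g, τ, σ, hg⟩ := g
  change polyRep n g (m n d e.1.1 e.1.2) ∈ W₁ n d
  rw [polyRep_m hd hg]
  exact Submodule.smul_mem _ _ (m_mem n d _ _)

/-- The action of `B(n)` on `(W₁)_ℂ`. -/
noncomputable def rep (n d : ℕ) : Representation ℂ (signedPermGroup n) (W₁ n d) :=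
  Representation.subrepresentation ((polyRep n).comp (signedPermGroup n).subtype) (W₁ n d)
    (W₁_le_comap n d)

theorem m_linearIndependent (n : ℕ) {d : ℕ} (hd : 2 ≤ d) :
    LinearIndependent ℂ fun e : Pairs n => m n d e.1.1 e.1.2 := by
  classical
  let ex : Fin n → Fin n → Fin n →₀ ℕ := fun i j =>
    Finsupp.single i (2 * d - 1) + Finsupp.single j 1
  have hm : ∀ i j, m n d i j = monomial (ex i j) (d : ℂ) - monomial (ex j i) (d : ℂ) := by
    intro i j
    have h : ∀ i j : Fin n, (monomial (ex i j) (d : ℂ) : MvPolynomial (Fin n) ℂ)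
        = C (d : ℂ) * (X i ^ (2 * d - 1) * X j) := by
      intro i j
      rw [X_pow_eq_monomial, X, monomial_mul, C_mul_monomial]
      simp [ex]
    rw [m_eq, h, h]
    ring
  have hex : ∀ i j k l : Fin n, i ≠ j → k ≠ l → ex i j = ex k l → i = k ∧ j = l := by
    intro i j k l hij hkl h
    have h1 := DFunLike.congr_fun h i
    have h2 := DFunLike.congr_fun h j
    simp only [ex, Finsupp.add_apply, Finsupp.single_apply] at h1 h2
    have hik : k = i := by
      by_contra hne
      simp only [if_true, if_neg hij.symm, if_neg hne] at h1
      split_ifs at h1 <;> omega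
    subst hik
    refine ⟨rfl, ?_⟩
    by_contra hne
    simp [hij, Ne.symm hne] at h2
  rw [Fintype.linearIndependent_iff]
  intro a ha e
  have hc := congrArg (coeff (ex e.1.1 e.1.2)) ha
  rw [coeff_sum, Finset.sum_eq_single e] at hc
  · have hne : ex e.1.2 e.1.1 ≠ ex e.1.1 e.1.2 := fun h =>
      e.2.ne (hex _ _ _ _ e.2.ne' e.2.ne h).2
    have hd0 : (d : ℂ) ≠ 0 := by
      have : d ≠ 0 := by omega
      exact_mod_cast this
    simpa [hm, coeff_monomial, hne, hd0] using hc
  · intro f _ hf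
    have h1 : ex f.1.1 f.1.2 ≠ ex e.1.1 e.1.2 := fun h => by
      obtain ⟨h1, h2⟩ := hex _ _ _ _ f.2.ne e.2.ne h
      exact hf (Subtype.ext (Prod.ext h1 h2))
    have h2 : ex f.1.2 f.1.1 ≠ ex e.1.1 e.1.2 := fun h => by
      obtain ⟨h1, h2⟩ := hex _ _ _ _ f.2.ne' e.2.ne h
      have := f.2
      have := e.2
      simp only [h1, h2] at *
      exact absurd ‹e.1.2 < e.1.1› (not_lt.2 e.2.le)
    simp [hm, coeff_monomial, h1, h2]
  · simp

/-- The basis `m_{ij}`, `i < j`, of `(W₁)_ℂ`. -/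
noncomputable def basisW₁ (n : ℕ) {d : ℕ} (hd : 2 ≤ d) : Module.Basis (Pairs n) ℂ (W₁ n d) :=
  Module.Basis.span (m_linearIndependent n hd)

section Coordinates

variable (n : ℕ) {d : ℕ} (hd : 2 ≤ d)

/-- The coordinate functions: `c_{ij}` with `i < j` form the dual basis of the `m_{ij}`, and
`c_{ji} = -c_{ij}`, so `c_{ii} = 0`. -/
noncomputable def c (i j : Fin n) : polyFun (W₁ n d) :=
  if h : i < j then linForm ((basisW₁ n hd).coord ⟨(i, j), h⟩)
  else if h : j < i then -linForm ((basisW₁ n hd).coord ⟨(j, i), h⟩)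
  else 0

/-- `u_i = ∑_{j ≠ i} c_{ij}²`. -/
noncomputable def u (i : Fin n) : polyFun (W₁ n d) :=
  ∑ j ∈ Finset.univ.erase i, c n hd i j ^ 2

/-- `p_l = ∑_{i < j} c_{ij}^{2l}`. -/
noncomputable def p (l : ℕ) : polyFun (W₁ n d) :=
  ∑ e : Pairs n, c n hd e.1.1 e.1.2 ^ (2 * l)

/-- `q_l = ∑_i u_i^l`. -/
noncomputable def q (l : ℕ) : polyFun (W₁ n d) :=
  ∑ i, u n hd i ^ l

/-- `z = ∑_{i < j < k} (u_i - u_j)(u_j - u_k)(u_k - u_i) c_{ij} c_{jk} c_{ki}`. -/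
noncomputable def z : polyFun (W₁ n d) :=
  ∑ t : {t : Fin n × Fin n × Fin n // t.1 < t.2.1 ∧ t.2.1 < t.2.2},
    (u n hd t.1.1 - u n hd t.1.2.1) * (u n hd t.1.2.1 - u n hd t.1.2.2) *
      (u n hd t.1.2.2 - u n hd t.1.1) *
      (c n hd t.1.1 t.1.2.1 * c n hd t.1.2.1 t.1.2.2 * c n hd t.1.2.2 t.1.1)

/-- The set of the `p_l` with `1 ≤ l ≤ n(n-1)/2`, the `q_l` with `2 ≤ l ≤ n`, and `z`. -/
noncomputable def generators : Set (polyFun (W₁ n d)) :=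
  {f | ∃ l, 1 ≤ l ∧ l ≤ n.choose 2 ∧ f = p n hd l} ∪
    {f | ∃ l, 2 ≤ l ∧ l ≤ n ∧ f = q n hd l} ∪ {z n hd}

end Coordinates

end SignedPermInvariants

/-! A point of `W₁` is an antisymmetric array `c i j`, that is, a weighting of the edges of the
complete graph on `n` vertices. A signed permutation relabels the vertices and multiplies `c i j` by
a product of vertex signs `τ i * τ j`.

The core is `exists_signedPerm_of_invariants_eq`, valid over any field of characteristic zero. Let
`c'` have the same invariants as a generic `c`. The `p_l` give a bijection `π` of edges matching the
squares, and the `q_l` a bijection `σ` of vertices matching the row sums. A row sum is the sum of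
the squares over the star of a vertex. Since the squares of `c` have distinct subset sums, `π`
carries the star of `i` to the star of `σ i`, so `π` is induced by `σ`. Thus `c' i j` is `c (σ i) (σ
j)` up to sign, and equality of the triangle sums forces these signs to have product `1` around
every triangle, hence to come from vertex signs.

Applied to evaluations at two points, this separates general orbits. Applied to the inclusion of
`ℂ[W₁]` in `ℂ(W₁)` and its composite with an automorphism fixing the generators, it shows that the
automorphism is the action of a signed permutation. Finally `ℂ(W₁)` is Galois over the generated
field, being the splitting field of the product of the `X² - c_{ij}²`, whose coefficients are
polynomials in the `p_l`. A rational invariant is fixed by the whole Galois group, so it lies in the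
generated field. -/

namespace SignedPermInvariants

/-! ### Power sums and Newton's identities. -/

section PowerSums

variable {ι : Type*} [Fintype ι]

/-- By Newton's identities, a subring closed under division by positive integers that contains the
power sums contains the elementary symmetric functions. -/
theorem esymm_mem_of_powerSums_mem {A : Type*} [CommRing A] (S : Subring A)
    (hS : ∀ (k : ℕ) (a : A), k ≠ 0 → (k : A) * a ∈ S → a ∈ S) (x : ι → A)
    (hx : ∀ l, 1 ≤ l → l ≤ Fintype.card ι → ∑ i, x i ^ l ∈ S) (k : ℕ)
    (hk : k ≤ Fintype.card ι) : (Finset.univ.val.map x).esymm k ∈ S := by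
  induction k using Nat.strong_induction_on with
  | _ k ih =>
    rcases Nat.eq_zero_or_pos k with rfl | h0
    · simp [Multiset.esymm]
    · refine hS k _ h0.ne' ?_
      have h := congrArg (MvPolynomial.aeval x) (MvPolynomial.mul_esymm_eq_sum ι ℤ k)
      simp only [map_mul, map_natCast, map_sum, map_pow, map_neg, map_one,
        MvPolynomial.aeval_esymm_eq_multiset_esymm] at h
      rw [h]
      have hneg : (-1 : A) ∈ S := S.neg_mem S.one_mem
      refine S.mul_mem (S.pow_mem hneg _) (S.sum_mem fun a ha => ?_)
      obtain ⟨ha, hlt⟩ := Finset.mem_filter.1 ha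
      rw [Finset.HasAntidiagonal.mem_antidiagonal] at ha
      refine S.mul_mem (S.mul_mem (S.pow_mem hneg _) (ih a.1 hlt (by omega))) ?_
      simp only [MvPolynomial.psum, map_sum, map_pow, MvPolynomial.aeval_X]
      exact hx a.2 (by omega) (by omega)

/-- Equal multisets give fibres of equal cardinality over every value, and bijections between the
fibres glue to a permutation. -/
theorem exists_perm_of_map_univ_eq {β : Type*} {x y : ι → β}
    (h : Finset.univ.val.map y = Finset.univ.val.map x) :
    ∃ π : Equiv.Perm ι, ∀ i, y i = x (π i) := by
  classical
  have hc : ∀ b, Fintype.card {i // y i = b} = Fintype.card {i // x i = b} := by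
    intro b
    have := congrArg (Multiset.count b) h
    simp only [Multiset.count_map] at this
    rw [Fintype.card_subtype, Fintype.card_subtype, Finset.card_def, Finset.card_def]
    simpa [eq_comm] using this
  refine ⟨Equiv.ofFiberEquiv (f := y) (g := x) fun b => Fintype.equivOfCardEq (hc b), fun i => ?_⟩
  exact (Equiv.ofFiberEquiv_map _ i).symm

/-- In characteristic zero, power sums determine a finite family up to a permutation. -/
theorem exists_perm_of_powerSums_eq {F : Type*} [Field F] [CharZero F] (x y : ι → F)
    (h : ∀ l, 1 ≤ l → l ≤ Fintype.card ι → ∑ i, y i ^ l = ∑ i, x i ^ l) :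
    ∃ π : Equiv.Perm ι, ∀ i, y i = x (π i) := by
  apply exists_perm_of_map_univ_eq
  have he : ∀ k ≤ Fintype.card ι,
      (Finset.univ.val.map y).esymm k = (Finset.univ.val.map x).esymm k := by
    intro k hk
    -- The subring is the diagonal of `F × F` and the family is `(y i, x i)`: membership in the
    -- diagonal means equality of the two coordinates.
    have := esymm_mem_of_powerSums_mem
      ((RingHom.fst F F).eqLocus (RingHom.snd F F)) (fun k a hk ha => by
        change (k : F) * a.1 = (k : F) * a.2 at ha
        exact mul_left_cancel₀ (Nat.cast_ne_zero.2 hk) ha) (fun i => (y i, x i))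
      (fun l h1 hl => by
        change RingHom.fst F F _ = RingHom.snd F F _
        simpa using h l h1 hl) k hk
    change RingHom.fst F F _ = RingHom.snd F F _ at this
    simpa [Finset.esymm_map_val] using this
  have hp : ((Finset.univ.val.map y).map fun t => Polynomial.X - Polynomial.C t).prod =
      ((Finset.univ.val.map x).map fun t => Polynomial.X - Polynomial.C t).prod := by
    rw [Multiset.prod_X_sub_X_eq_sum_esymm, Multiset.prod_X_sub_X_eq_sum_esymm]
    simp only [Multiset.card_map]
    refine Finset.sum_congr rfl fun j hj => ?_
    rw [he j]
    simpa [Nat.lt_succ_iff] using hj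
  have hr := congrArg Polynomial.roots hp
  rwa [Polynomial.roots_multiset_prod_X_sub_C, Polynomial.roots_multiset_prod_X_sub_C] at hr

end PowerSums

/-! ### Reconstruction of a generic array from its invariants. -/

section Combinatorics

variable {n : ℕ} {A : Type*} [CommRing A]

/-- The row sums `∑_j c_{ij}²`. -/
def rowSum (c : Fin n → Fin n → A) (i : Fin n) : A := ∑ j, c i j ^ 2

/-- The summand of the triangle invariant. -/
def triangleTerm (c : Fin n → Fin n → A) (i j k : Fin n) : A :=
  (rowSum c i - rowSum c j) * (rowSum c j - rowSum c k) * (rowSum c k - rowSum c i) *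
    (c i j * c j k * c k i)

/-- The sum of the triangle terms over all triples. -/
def triangleSum (c : Fin n → Fin n → A) : A := ∑ i, ∑ j, ∑ k, triangleTerm c i j k

/-- The array obtained from `c` by changing signs. -/
def signChange (ε : Fin n → Fin n → ℤˣ) (c : Fin n → Fin n → A) (i j : Fin n) : A :=
  ((ε i j : ℤ) : A) * c i j

/-- The squares of the entries, as a family indexed by the pairs `i < j`. -/
def sqFamily (c : Fin n → Fin n → A) (e : Pairs n) : A := c e.1.1 e.1.2 ^ 2

/-- The genericity conditions: the squares have distinct subset sums, and only the sign changes
that are trivial on triangles preserve the triangle sum. -/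
structure IsGeneric (c : Fin n → Fin n → A) : Prop where
  subset_sums : ∀ S T : Finset (Pairs n),
    ∑ e ∈ S, sqFamily c e = ∑ e ∈ T, sqFamily c e → S = T
  triangles : ∀ ε : Fin n → Fin n → ℤˣ, (∀ i j, ε i j = ε j i) →
    triangleSum (signChange ε c) = triangleSum c →
      ∀ i j k, i ≠ j → j ≠ k → k ≠ i → ε i j * ε j k * ε k i = 1

theorem signUnit_sq (s : ℤˣ) : ((s : ℤ) : A) ^ 2 = 1 := by
  rcases Int.units_eq_one_or s with h | h <;> simp [h]

theorem diag_eq_zero {F : Type*} [Field F] [CharZero F] {c : Fin n → Fin n → F}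
    (hc : ∀ i j, c j i = -c i j) (i : Fin n) : c i i = 0 :=
  self_eq_neg.1 (hc i i)

/-- The pair with the given distinct end points. -/
def mkPair (i j : Fin n) (h : i ≠ j) : Pairs n :=
  if hlt : i < j then ⟨(i, j), hlt⟩ else ⟨(j, i), lt_of_le_of_ne (not_lt.1 hlt) h.symm⟩

/-- The pairs with `i` as an end point. -/
def star (i : Fin n) : Finset (Pairs n) := {e | e.1.1 = i ∨ e.1.2 = i}

theorem mem_star {i : Fin n} {e : Pairs n} : e ∈ star i ↔ e.1.1 = i ∨ e.1.2 = i := by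
  simp [star]

theorem sqFamily_mkPair {c : Fin n → Fin n → A} (hc : ∀ i j, c j i = -c i j) (i j : Fin n)
    (h : i ≠ j) : sqFamily c (mkPair i j h) = c i j ^ 2 := by
  unfold mkPair sqFamily
  split_ifs
  · rfl
  · simp [hc i j]

theorem mkPair_mem_star {i j : Fin n} (h : i ≠ j) (k : Fin n) :
    mkPair i j h ∈ star k ↔ i = k ∨ j = k := by
  rw [mem_star]
  unfold mkPair
  split_ifs
  · rfl
  · exact or_comm

theorem sqFamily_of_mem_star {c : Fin n → Fin n → A} (hc : ∀ i j, c j i = -c i j) {i j : Fin n}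
    (h : i ≠ j) {e : Pairs n} (hi : e ∈ star i) (hj : e ∈ star j) :
    sqFamily c e = c i j ^ 2 := by
  rw [mem_star] at hi hj
  unfold sqFamily
  rcases hi with hi | hi <;> rcases hj with hj | hj
  · exact absurd (hi.symm.trans hj) h
  · rw [hi, hj]
  · rw [hi, hj, hc i j, neg_sq]
  · exact absurd (hi.symm.trans hj) h

theorem rowSum_eq_sum_star {c : Fin n → Fin n → A} (hc : ∀ i j, c j i = -c i j)
    (h0 : ∀ i, c i i = 0) (i : Fin n) : rowSum c i = ∑ e ∈ star i, sqFamily c e := by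
  have h1 : rowSum c i = ∑ j ∈ Finset.univ.erase i, c i j ^ 2 := by
    rw [rowSum, ← Finset.add_sum_erase _ _ (Finset.mem_univ i), h0]
    simp
  rw [h1]
  refine Finset.sum_bij (fun j hj => mkPair i j (Finset.ne_of_mem_erase hj).symm) ?_ ?_ ?_ ?_
  · intro j hj
    simp [mkPair_mem_star]
  · intro j hj k hk h
    have := (mkPair_mem_star (Finset.ne_of_mem_erase hj).symm k).1 (by
      rw [h, mkPair_mem_star]
      simp)
    exact this.resolve_left (Finset.ne_of_mem_erase hk).symm
  · intro e he
    have hlt := e.2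
    rcases mem_star.1 he with h | h
    · refine ⟨e.1.2, by simp only [Finset.mem_erase, Finset.mem_univ, and_true]; exact h ▸ hlt.ne',
        ?_⟩
      apply Subtype.ext
      simp [mkPair, ← h, hlt]
    · refine ⟨e.1.1, by simp only [Finset.mem_erase, Finset.mem_univ, and_true]; exact h ▸ hlt.ne,
        ?_⟩
      apply Subtype.ext
      simp [mkPair, ← h, hlt.not_gt]
  · intro j hj
    rw [sqFamily_mkPair hc]

theorem rowSum_signChange (ε : Fin n → Fin n → ℤˣ) (c : Fin n → Fin n → A) (i : Fin n) :
    rowSum (signChange ε c) i = rowSum c i := by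
  simp only [rowSum, signChange, mul_pow, signUnit_sq, one_mul]

theorem rowSum_comp_perm (σ : Equiv.Perm (Fin n)) (c : Fin n → Fin n → A) (i : Fin n) :
    rowSum (fun i j => c (σ i) (σ j)) i = rowSum c (σ i) :=
  Equiv.sum_comp σ fun j => c (σ i) j ^ 2

theorem triangleSum_comp_perm (σ : Equiv.Perm (Fin n)) (c : Fin n → Fin n → A) :
    triangleSum (fun i j => c (σ i) (σ j)) = triangleSum c := by
  refine Fintype.sum_equiv σ _ _ fun i => Fintype.sum_equiv σ _ _ fun j =>
    Fintype.sum_equiv σ _ _ fun k => ?_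
  simp only [triangleTerm, rowSum_comp_perm]

theorem triangleTerm_signChange (ε : Fin n → Fin n → ℤˣ) (c : Fin n → Fin n → A)
    (i j k : Fin n) : triangleTerm (signChange ε c) i j k =
      ((ε i j * ε j k * ε k i : ℤˣ) : ℤ) * triangleTerm c i j k := by
  simp only [triangleTerm, rowSum_signChange]
  simp only [signChange, Units.val_mul, Int.cast_mul]
  ring

/-- Signs that multiply to `1` around every triangle come from signs on the vertices. -/
theorem exists_vertex_signs (ε : Fin n → Fin n → ℤˣ) (hε : ∀ i j, ε i j = ε j i)
    (h : ∀ i j k, i ≠ j → j ≠ k → k ≠ i → ε i j * ε j k * ε k i = 1) :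
    ∃ τ : Fin n → ℤˣ, ∀ i j, i ≠ j → ε i j = τ i * τ j := by
  rcases isEmpty_or_nonempty (Fin n) with hn | ⟨⟨o⟩⟩
  · exact ⟨1, fun i => hn.elim i⟩
  refine ⟨fun i => if i = o then 1 else ε o i, fun i j hij => ?_⟩
  rcases eq_or_ne i o with rfl | hi
  · simp [hij.symm]
  rcases eq_or_ne j o with rfl | hj
  · simp [hij, hε i j]
  simp only [if_neg hi, if_neg hj]
  -- The signs at the vertices are read off the edges to the base vertex `o`; the triangle `i, j, o`
  -- compares them with `ε i j`.
  have := h i j o hij hj hi.symm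
  rw [hε j o, mul_assoc] at this
  rw [eq_inv_of_mul_eq_one_left this, Int.units_inv_eq_self, mul_comm]

/-- An array with the same invariants as a generic array is obtained from it by a signed
permutation. -/
theorem exists_signedPerm_of_invariants_eq {F : Type*} [Field F] [CharZero F]
    {c c' : Fin n → Fin n → F} (hc : ∀ i j, c j i = -c i j) (hc' : ∀ i j, c' j i = -c' i j)
    (hgen : IsGeneric c)
    (hp : ∀ l, 1 ≤ l → l ≤ Fintype.card (Pairs n) →
      ∑ e, sqFamily c' e ^ l = ∑ e, sqFamily c e ^ l)
    (hq : ∀ l, 1 ≤ l → l ≤ n → ∑ i, rowSum c' i ^ l = ∑ i, rowSum c i ^ l)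
    (hz : triangleSum c' = triangleSum c) :
    ∃ (τ : Fin n → ℤˣ) (σ : Equiv.Perm (Fin n)),
      ∀ i j, c' i j = (((τ i * τ j : ℤˣ) : ℤ) : F) * c (σ i) (σ j) := by
  have h0 := diag_eq_zero hc
  have h0' := diag_eq_zero hc'
  obtain ⟨π, hπ⟩ := exists_perm_of_powerSums_eq (sqFamily c) (sqFamily c') hp
  obtain ⟨σ, hσ⟩ := exists_perm_of_powerSums_eq (rowSum c) (rowSum c')
    (by simpa only [Fintype.card_fin] using hq)
  have hstar : ∀ i, (star i).map π.toEmbedding = star (σ i) := by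
    intro i
    apply hgen.subset_sums
    rw [Finset.sum_map, ← rowSum_eq_sum_star hc h0, ← hσ, rowSum_eq_sum_star hc' h0']
    exact Finset.sum_congr rfl fun e _ => (hπ e).symm
  have hmem : ∀ i e, e ∈ star i → π e ∈ star (σ i) := fun i e he => by
    rw [← hstar]
    exact Finset.mem_map_of_mem _ he
  -- The pair of `i` and `j` is the only one in both stars, so its image under `π` is the pair of `σ
  -- i` and `σ j`.
  have hsq : ∀ i j, c' i j ^ 2 = c (σ i) (σ j) ^ 2 := by
    intro i j
    rcases eq_or_ne i j with rfl | hij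
    · rw [h0, h0']
    rw [← sqFamily_mkPair hc' i j hij, hπ]
    exact sqFamily_of_mem_star hc (σ.injective.ne hij)
      (hmem _ _ ((mkPair_mem_star hij i).2 (Or.inl rfl)))
      (hmem _ _ ((mkPair_mem_star hij j).2 (Or.inr rfl)))
  classical
  -- Where both entries vanish the sign is `1`. The test is symmetric in `i` and `j` because both
  -- arrays are antisymmetric.
  let s : Fin n → Fin n → ℤˣ := fun i j => if c' i j = c (σ i) (σ j) then 1 else -1
  have hs : ∀ i j, s i j = s j i := fun i j => by
    simp only [s, hc' i j, hc (σ i) (σ j), neg_inj]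
  have hcs : ∀ i j, c' i j = ((s i j : ℤ) : F) * c (σ i) (σ j) := by
    intro i j
    by_cases h : c' i j = c (σ i) (σ j)
    · simp [s, h]
    · simpa [s, h] using (sq_eq_sq_iff_eq_or_eq_neg.1 (hsq i j)).resolve_left h
  let ε : Fin n → Fin n → ℤˣ := fun i j => s (σ.symm i) (σ.symm j)
  have hcε : c' = fun i j => signChange ε c (σ i) (σ j) := by
    ext i j
    simp [signChange, ε, hcs i j]
  rw [hcε, triangleSum_comp_perm] at hz
  obtain ⟨τ, hτ⟩ := exists_vertex_signs ε (fun i j => hs _ _)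
    (hgen.triangles ε (fun i j => hs _ _) hz)
  refine ⟨fun i => τ (σ i), σ, fun i j => ?_⟩
  rcases eq_or_ne i j with rfl | hij
  · rw [h0, h0', mul_zero]
  · rw [← hτ _ _ (σ.injective.ne hij), hcε]
    rfl

end Combinatorics

/-! ### Invariance under signed permutations, and ordered versus unordered sums. -/

section Invariance

variable {n : ℕ} {A : Type*} [CommRing A]

theorem sum_sum_eq_two_mul_sum_pairs (f : Fin n → Fin n → A) (hf : ∀ i j, f i j = f j i)
    (h0 : ∀ i, f i i = 0) : ∑ i, ∑ j, f i j = 2 * ∑ e : Pairs n, f e.1.1 e.1.2 := by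
  have h1 : ∑ e : Pairs n, f e.1.1 e.1.2 = ∑ i, ∑ j, if i < j then f i j else 0 := by
    rw [← Fintype.sum_prod_type' (f := fun i j => if i < j then f i j else 0),
      ← Finset.sum_filter]
    exact (Finset.sum_subtype _ (by simp) fun x : Fin n × Fin n => f x.1 x.2).symm
  have h2 : ∑ i, ∑ j, (if i < j then f i j else 0) = ∑ i, ∑ j, if j < i then f i j else 0 := by
    rw [Finset.sum_comm]
    simp only [hf]
  rw [two_mul, h1]
  nth_rw 2 [h2]
  simp only [← Finset.sum_add_distrib]
  refine Finset.sum_congr rfl fun i _ => Finset.sum_congr rfl fun j _ => ?_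
  rcases lt_trichotomy i j with h | rfl | h
  · simp [h, h.not_gt]
  · simp [h0]
  · simp [h, h.not_gt]

theorem sum_sum_sum_eq_six_mul_sum_triples (f : Fin n → Fin n → Fin n → A)
    (h₁ : ∀ i j k, f i j k = f j i k) (h₂ : ∀ i j k, f i j k = f i k j)
    (h0 : ∀ i k, f i i k = 0) :
    ∑ i, ∑ j, ∑ k, f i j k =
      6 * ∑ t : {t : Fin n × Fin n × Fin n // t.1 < t.2.1 ∧ t.2.1 < t.2.2},
        f t.1.1 t.1.2.1 t.1.2.2 := by
  let g : Fin n → Fin n → Fin n → A := fun i j k => if i < j ∧ j < k then f i j k else 0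
  have hg : ∑ t : {t : Fin n × Fin n × Fin n // t.1 < t.2.1 ∧ t.2.1 < t.2.2},
      f t.1.1 t.1.2.1 t.1.2.2 = ∑ i, ∑ j, ∑ k, g i j k := by
    simp only [← Fintype.sum_prod_type']
    rw [← Finset.sum_filter]
    exact (Finset.sum_subtype _ (by simp)
      fun x : Fin n × Fin n × Fin n => f x.1 x.2.1 x.2.2).symm
  -- For distinct indices exactly one of the six orderings is increasing; if two indices coincide,
  -- both sides vanish.
  have hsplit : ∀ i j k, f i j k =
      g i j k + g i k j + g j i k + g j k i + g k i j + g k j i := by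
    intro i j k
    have e1 : f i k j = f i j k := (h₂ i j k).symm
    have e2 : f j i k = f i j k := (h₁ i j k).symm
    have e3 : f j k i = f i j k := by rw [← h₂, e2]
    have e4 : f k i j = f i j k := by rw [h₁, e1]
    have e5 : f k j i = f i j k := by rw [h₁, e3]
    have e6 : ∀ a b, f a b b = 0 := fun a b => by rw [h₁, h₂, h0]
    have e7 : ∀ a b, f a b a = 0 := fun a b => by rw [h₂, h0]
    simp only [g, e1, e2, e3, e4, e5]
    rcases lt_trichotomy i j with hij | rfl | hij
    · rcases lt_trichotomy j k with hjk | rfl | hjk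
      · simp [hij, hjk, hij.not_gt, hjk.not_gt, (hij.trans hjk).not_gt]
      · simp [e6]
      · rcases lt_trichotomy i k with hik | rfl | hik
        · simp [hij, hjk, hik, hij.not_gt, hjk.not_gt, hik.not_gt]
        · simp [e7]
        · simp [hij, hjk, hik, hij.not_gt, hjk.not_gt, hik.not_gt]
    · simp [h0]
    · rcases lt_trichotomy j k with hjk | rfl | hjk
      · rcases lt_trichotomy i k with hik | rfl | hik
        · simp [hij, hjk, hik, hij.not_gt, hjk.not_gt, hik.not_gt]
        · simp [e7]
        · simp [hij, hjk, hik, hij.not_gt, hjk.not_gt, hik.not_gt]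
      · simp [e6]
      · simp [hij, hjk, hij.not_gt, hjk.not_gt, (hjk.trans hij).not_gt]
  have s1 : ∑ i, ∑ j, ∑ k, g i k j = ∑ i, ∑ j, ∑ k, g i j k :=
    Finset.sum_congr rfl fun i _ => Finset.sum_comm
  have s2 : ∑ i, ∑ j, ∑ k, g j i k = ∑ i, ∑ j, ∑ k, g i j k := Finset.sum_comm
  have s3 : ∑ i, ∑ j, ∑ k, g j k i = ∑ i, ∑ j, ∑ k, g i j k := by
    rw [Finset.sum_comm, ← s1]
  have s4 : ∑ i, ∑ j, ∑ k, g k i j = ∑ i, ∑ j, ∑ k, g i j k := by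
    rw [← s2, ← Finset.sum_congr rfl fun i _ => Finset.sum_comm]
  have s5 : ∑ i, ∑ j, ∑ k, g k j i = ∑ i, ∑ j, ∑ k, g i j k := by
    rw [Finset.sum_comm, s4]
  rw [hg]
  simp only [hsplit, Finset.sum_add_distrib]
  rw [s1, s2, s3, s4, s5]
  ring

/-- A permutation does not preserve the condition `i < j`, so twice the sum is compared instead, as
a sum over all ordered pairs. The diagonal terms vanish because `l ≥ 1`. -/
theorem sum_sqFamily_pow_signedPerm {c c' : Fin n → Fin n → A} (hc : ∀ i j, c j i = -c i j)
    (h0 : ∀ i, c i i = 0) (h2 : ∀ a b : A, 2 * a = 2 * b → a = b) (τ : Fin n → ℤˣ)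
    (σ : Equiv.Perm (Fin n))
    (h : ∀ i j, c' i j = (((τ i * τ j : ℤˣ) : ℤ) : A) * c (σ i) (σ j)) {l : ℕ} (hl : 1 ≤ l) :
    ∑ e, sqFamily c' e ^ l = ∑ e, sqFamily c e ^ l := by
  have hl0 : l ≠ 0 := by omega
  have hsq : ∀ i j, c' i j ^ 2 = c (σ i) (σ j) ^ 2 := fun i j => by
    rw [h, mul_pow, signUnit_sq, one_mul]
  apply h2
  unfold sqFamily
  rw [← sum_sum_eq_two_mul_sum_pairs (fun i j => (c' i j ^ 2) ^ l)
      (fun i j => by rw [hsq, hsq, hc (σ i) (σ j), neg_sq]) (fun i => by simp [hsq, h0, hl0]),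
    ← sum_sum_eq_two_mul_sum_pairs (fun i j => (c i j ^ 2) ^ l)
      (fun i j => by rw [hc i j, neg_sq]) (fun i => by simp [h0, hl0])]
  refine Fintype.sum_equiv σ _ _ fun i => Fintype.sum_equiv σ _ _ fun j => ?_
  rw [hsq]

theorem rowSum_signedPerm {c c' : Fin n → Fin n → A} (τ : Fin n → ℤˣ) (σ : Equiv.Perm (Fin n))
    (h : ∀ i j, c' i j = (((τ i * τ j : ℤˣ) : ℤ) : A) * c (σ i) (σ j)) (i : Fin n) :
    rowSum c' i = rowSum c (σ i) := by
  have : c' = signChange (fun i j => τ i * τ j) fun i j => c (σ i) (σ j) := by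
    ext i j
    exact h i j
  rw [this, rowSum_signChange, rowSum_comp_perm]

theorem triangleSum_signedPerm {c c' : Fin n → Fin n → A} (τ : Fin n → ℤˣ)
    (σ : Equiv.Perm (Fin n))
    (h : ∀ i j, c' i j = (((τ i * τ j : ℤˣ) : ℤ) : A) * c (σ i) (σ j)) :
    triangleSum c' = triangleSum c := by
  have : c' = signChange (fun i j => τ i * τ j) fun i j => c (σ i) (σ j) := by
    ext i j
    exact h i j
  rw [this, ← triangleSum_comp_perm σ c]
  unfold triangleSum
  refine Finset.sum_congr rfl fun i _ => Finset.sum_congr rfl fun j _ =>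
    Finset.sum_congr rfl fun k _ => ?_
  rw [triangleTerm_signChange]
  -- Every vertex of a triangle lies on two of its edges, so its sign occurs twice.
  have : τ i * τ j * (τ j * τ k) * (τ k * τ i) = 1 := by
    calc _ = (τ i * τ i) * (τ j * τ j) * (τ k * τ k) := by
          simp only [mul_comm, mul_left_comm]
      _ = 1 := by simp only [Int.units_mul_self, mul_one]
  simp [this]

variable {B : Type*} [CommRing B] (φ : A →+* B)

theorem map_rowSum (c : Fin n → Fin n → A) (i : Fin n) :
    rowSum (fun i j => φ (c i j)) i = φ (rowSum c i) := by
  simp [rowSum]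

theorem map_triangleSum (c : Fin n → Fin n → A) :
    triangleSum (fun i j => φ (c i j)) = φ (triangleSum c) := by
  simp only [triangleSum, triangleTerm, map_rowSum, map_sum, map_mul, map_sub]

theorem map_sqFamily (c : Fin n → Fin n → A) (e : Pairs n) :
    sqFamily (fun i j => φ (c i j)) e = φ (sqFamily c e) := by
  simp [sqFamily]

theorem map_signChange (ε : Fin n → Fin n → ℤˣ) (c : Fin n → Fin n → A) :
    (fun i j => φ (signChange ε c i j)) = signChange ε fun i j => φ (c i j) := by
  ext i j
  simp [signChange]

/-- Genericity passes to the image under an injective homomorphism. -/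
theorem IsGeneric.map {c : Fin n → Fin n → A} (hc : IsGeneric c) (hφ : Function.Injective φ) :
    IsGeneric fun i j => φ (c i j) where
  subset_sums S T h := by
    simp only [map_sqFamily, ← map_sum] at h
    exact hc.subset_sums S T (hφ h)
  triangles ε hε h := by
    rw [← map_signChange, map_triangleSum, map_triangleSum] at h
    exact hc.triangles ε hε (hφ h)

end Invariance

/-! ### The coordinates on `W₁` and the action on them. -/

section Coordinates

variable {n d : ℕ} (hd : 2 ≤ d)

theorem exists_isSignedPerm (τ : Fin n → ℤˣ) (σ : Equiv.Perm (Fin n)) :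
    ∃ g : signedPermGroup n, IsSignedPerm g.1.1 τ σ := by
  let M : Matrix (Fin n) (Fin n) ℝ := fun i j => if i = σ j then ((τ i : ℤ) : ℝ) else 0
  have hM : M ∈ Matrix.orthogonalGroup (Fin n) ℝ := by
    rw [Matrix.mem_orthogonalGroup_iff']
    ext i j
    rw [Matrix.mul_apply, Finset.sum_eq_single (σ j)]
    · rw [Matrix.transpose_apply]
      rcases eq_or_ne i j with rfl | hij
      · simp [M, ← sq, signUnit_sq]
      · rw [Matrix.one_apply_ne hij]
        simp [M, hij.symm]
    · intro k _ hk
      simp [M, hk]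
    · simp
  exact ⟨⟨⟨M, hM⟩, τ, σ, fun i j => rfl⟩, fun i j => rfl⟩

theorem c_swap (i j : Fin n) : c n hd j i = -c n hd i j := by
  unfold c
  rcases lt_trichotomy i j with h | rfl | h
  · simp [h, h.not_gt]
  · simp
  · simp [h, h.not_gt]

theorem c_self (i : Fin n) : c n hd i i = 0 := by
  simp [c]

theorem c_apply_of_lt {i j : Fin n} (h : i < j) (v : W₁ n d) :
    (c n hd i j).1 v = (basisW₁ n hd).repr v ⟨(i, j), h⟩ := by
  simp [c, h, linForm]

theorem c_swap_apply (i j : Fin n) (v : W₁ n d) : (c n hd j i).1 v = -(c n hd i j).1 v := by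
  rw [c_swap]
  rfl

theorem c_self_apply (i : Fin n) (v : W₁ n d) : (c n hd i i).1 v = 0 := by
  rw [c_self]
  rfl

/-- `c_{ij}`, as a linear form. -/
theorem exists_linearMap_c (i j : Fin n) :
    ∃ f : W₁ n d →ₗ[ℂ] ℂ, ∀ v, (c n hd i j).1 v = f v := by
  rcases lt_trichotomy i j with h | rfl | h
  · exact ⟨(basisW₁ n hd).coord ⟨(i, j), h⟩, fun v => c_apply_of_lt hd h v⟩
  · exact ⟨0, fun v => c_self_apply hd i v⟩
  · exact ⟨-(basisW₁ n hd).coord ⟨(j, i), h⟩, fun v => by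
      rw [c_swap_apply, c_apply_of_lt hd h]
      rfl⟩

theorem basisW₁_apply (e : Pairs n) :
    basisW₁ n hd e = ⟨m n d e.1.1 e.1.2, m_mem n d _ _⟩ :=
  Module.Basis.span_apply (m_linearIndependent n hd) e

/-- The second indicator makes the formula hold for all orders of the indices, coincident ones
included; `c_rep` needs this because `σ` need not preserve the order. -/
theorem c_m (i j k l : Fin n) : (c n hd i j).1 ⟨m n d k l, m_mem n d k l⟩ =
    (if i = k ∧ j = l then 1 else 0) - if i = l ∧ j = k then 1 else 0 := by
  have key : ∀ i j k l : Fin n, i < j → k < l →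
      (c n hd i j).1 ⟨m n d k l, m_mem n d k l⟩ = if i = k ∧ j = l then 1 else 0 := by
    intro i j k l hij hkl
    have := basisW₁_apply hd ⟨(k, l), hkl⟩
    rw [c_apply_of_lt hd hij, ← this, Module.Basis.repr_self, Finsupp.single_apply]
    simp [eq_comm]
  have hanti : ∀ i j k l : Fin n, (c n hd i j).1 ⟨m n d l k, m_mem n d l k⟩ =
      -(c n hd i j).1 ⟨m n d k l, m_mem n d k l⟩ := by
    intro i j k l
    obtain ⟨f, hf⟩ := exists_linearMap_c hd i j
    rw [hf, hf, ← map_neg]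
    congr 1
    exact Subtype.ext (m_swap n d k l)
  have key' : ∀ i j k l : Fin n, i < j →
      (c n hd i j).1 ⟨m n d k l, m_mem n d k l⟩ =
        (if i = k ∧ j = l then 1 else 0) - if i = l ∧ j = k then 1 else 0 := by
    intro i j k l hij
    rcases lt_trichotomy k l with h | rfl | h
    · rw [key _ _ _ _ hij h, if_neg (c := i = l ∧ j = k), sub_zero]
      rintro ⟨rfl, rfl⟩
      exact h.not_gt hij
    · rw [sub_self]
      exact self_eq_neg.1 (hanti i j k k)
    · rw [hanti i j l k, key _ _ _ _ hij h, if_neg (c := i = k ∧ j = l), zero_sub]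
      rintro ⟨rfl, rfl⟩
      exact h.not_gt hij
  rcases lt_trichotomy i j with h | rfl | h
  · exact key' i j k l h
  · rw [c_self_apply]
    simp [and_comm]
  · rw [c_swap_apply, key' j i k l h, neg_sub]
    simp [and_comm]

theorem c_rep {g : signedPermGroup n} {τ : Fin n → ℤˣ} {σ : Equiv.Perm (Fin n)}
    (hg : IsSignedPerm g.1.1 τ σ) (i j : Fin n) (v : W₁ n d) :
    (c n hd (σ i) (σ j)).1 (rep n d g v) =
      (((τ (σ i) * τ (σ j) : ℤˣ) : ℤ) : ℂ) * (c n hd i j).1 v := by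
  obtain ⟨f, hf⟩ := exists_linearMap_c hd i j
  obtain ⟨f', hf'⟩ := exists_linearMap_c hd (σ i) (σ j)
  rw [hf, hf']
  suffices h : f'.comp (rep n d g) = (((τ (σ i) * τ (σ j) : ℤˣ) : ℤ) : ℂ) • f from
    LinearMap.congr_fun h v
  refine (basisW₁ n hd).ext fun e => ?_
  have hr : rep n d g (basisW₁ n hd e) =
      (((τ (σ e.1.1) * τ (σ e.1.2) : ℤˣ) : ℤ) : ℂ) •
        (⟨m n d (σ e.1.1) (σ e.1.2), m_mem n d _ _⟩ : W₁ n d) := by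
    rw [basisW₁_apply]
    exact Subtype.ext (polyRep_m (by omega) hg _ _)
  rw [LinearMap.comp_apply, hr, map_smul, LinearMap.smul_apply, basisW₁_apply, ← hf, ← hf', c_m,
    c_m]
  simp only [σ.injective.eq_iff, smul_eq_mul]
  by_cases h1 : i = e.1.1 ∧ j = e.1.2
  · obtain ⟨rfl, rfl⟩ := h1
    rfl
  by_cases h2 : i = e.1.2 ∧ j = e.1.1
  · obtain ⟨rfl, rfl⟩ := h2
    rw [mul_comm (τ (σ e.1.1))]
  · simp [h1, h2]

theorem polyAct_c {g : signedPermGroup n} {τ : Fin n → ℤˣ} {σ : Equiv.Perm (Fin n)}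
    (hg : IsSignedPerm g.1.1 τ σ) (i j : Fin n) :
    polyAct (rep n d) g (c n hd i j) =
      (((τ (σ i) * τ (σ j) : ℤˣ) : ℤ) : polyFun (W₁ n d)) * c n hd (σ i) (σ j) := by
  have key : ((((τ (σ i) * τ (σ j) : ℤˣ) : ℤ) : polyFun (W₁ n d))) *
      polyAct (rep n d) g (c n hd i j) = c n hd (σ i) (σ j) := by
    apply Subtype.ext
    funext v
    have h := c_rep hd hg i j (rep n d g⁻¹ v)
    rw [Representation.self_inv_apply] at h
    rw [h]
    simp [polyAct]
    rfl
  rw [← key, ← mul_assoc, ← sq, signUnit_sq, one_mul]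

theorem eq_of_c_eq {v w : W₁ n d} (h : ∀ i j, (c n hd i j).1 v = (c n hd i j).1 w) : v = w := by
  refine (basisW₁ n hd).ext_elem fun e => ?_
  have := h e.1.1 e.1.2
  rwa [c_apply_of_lt hd e.2, c_apply_of_lt hd e.2] at this

theorem exists_c_eq (a : Fin n → Fin n → ℂ) (ha : ∀ i j, a j i = -a i j) :
    ∃ v : W₁ n d, ∀ i j, (c n hd i j).1 v = a i j := by
  let v := (basisW₁ n hd).equivFun.symm fun e => a e.1.1 e.1.2
  have hv : ∀ i j, i < j → (c n hd i j).1 v = a i j := fun i j h => by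
    rw [c_apply_of_lt hd h, ← Module.Basis.equivFun_apply]
    simp only [v, LinearEquiv.apply_symm_apply]
  refine ⟨v, fun i j => ?_⟩
  rcases lt_trichotomy i j with h | rfl | h
  · exact hv i j h
  · rw [c_self_apply, diag_eq_zero ha]
  · rw [c_swap_apply, hv j i h, ha, neg_neg]

theorem adjoin_c_eq_top :
    Algebra.adjoin ℂ (Set.range fun e : Fin n × Fin n => c n hd e.1 e.2) = ⊤ := by
  rw [eq_top_iff]
  set T := Algebra.adjoin ℂ (Set.range fun e : Fin n × Fin n => c n hd e.1 e.2) with hT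
  have h : polyFun (W₁ n d) ≤ T.map (polyFun (W₁ n d)).val := by
    refine Algebra.adjoin_le ?_
    rintro _ ⟨φ, rfl⟩
    refine ⟨∑ e : Pairs n, φ (basisW₁ n hd e) • c n hd e.1.1 e.1.2,
      T.sum_mem fun e _ => T.smul_mem (Algebra.subset_adjoin ⟨e.1, rfl⟩) _, ?_⟩
    funext v
    have h1 : φ v = ∑ e, (basisW₁ n hd).repr v e * φ (basisW₁ n hd e) := by
      conv_lhs => rw [← (basisW₁ n hd).sum_repr v]
      simp only [map_sum, map_smul, smul_eq_mul]
    change _ = φ v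
    rw [h1]
    simp only [RingHom.coe_coe, map_sum, map_smul, Subalgebra.coe_val, Finset.sum_apply,
      Pi.smul_apply, smul_eq_mul]
    refine Finset.sum_congr rfl fun e _ => ?_
    rw [mul_comm]
    exact congrArg (· * _) (c_apply_of_lt hd e.2 v)
  intro p _
  obtain ⟨x, hx, hxp⟩ := h p.2
  rwa [← show x = p from Subtype.ext hxp]

theorem p_eq (l : ℕ) : p n hd l = ∑ e, sqFamily (c n hd) e ^ l := by
  simp only [p, sqFamily, pow_mul]

theorem u_eq (i : Fin n) : u n hd i = rowSum (c n hd) i := by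
  rw [rowSum, ← Finset.add_sum_erase _ _ (Finset.mem_univ i), c_self, u]
  simp

theorem q_eq (l : ℕ) : q n hd l = ∑ i, rowSum (c n hd) i ^ l := by
  simp only [q, u_eq]

/-- The product of differences and the cyclic product both change sign under transpositions, so the
triangle term is symmetric and each triangle is counted six times. -/
theorem six_mul_z : 6 * z n hd = triangleSum (c n hd) := by
  rw [triangleSum, sum_sum_sum_eq_six_mul_sum_triples]
  · simp only [z, u_eq, triangleTerm]
  · intro i j k
    simp only [triangleTerm]
    rw [c_swap hd i j, c_swap hd k j, c_swap hd i k]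
    ring
  · intro i j k
    simp only [triangleTerm]
    rw [c_swap hd k i, c_swap hd j k, c_swap hd i j]
    ring
  · intro i k
    simp [triangleTerm]

theorem q_one : q n hd 1 = 2 * p n hd 1 := by
  simp only [q_eq, p_eq, pow_one, rowSum]
  exact sum_sum_eq_two_mul_sum_pairs (fun i j => c n hd i j ^ 2)
    (fun i j => by rw [c_swap hd i j]; ring) fun i => by simp [c_self]

theorem card_pairs (n : ℕ) : Fintype.card (Pairs n) = n.choose 2 := by
  rw [Fintype.card_subtype, Fintype.card_product_filter_lt, Fintype.card_fin]

end Coordinates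

/-! ### Genericity of the coordinates and separation of orbits. -/

section Genericity

variable {n d : ℕ} (hd : 2 ≤ d)

/-- Evaluation of polynomial functions at a point. -/
def evalAt {W : Type*} [AddCommGroup W] [Module ℂ W] (v : W) : polyFun W →+* ℂ :=
  (Pi.evalRingHom (fun _ : W => ℂ) v).comp (polyFun W).val.toRingHom

theorem evalAt_apply {W : Type*} [AddCommGroup W] [Module ℂ W] (v : W) (f : polyFun W) :
    evalAt v f = f.1 v := rfl

/-- An antisymmetric array supported on a triangle whose triangle term there is nonzero. -/
theorem exists_triangle_array {i j k : Fin n} (hij : i ≠ j) (hjk : j ≠ k) (hki : k ≠ i) :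
    ∃ a : Fin n → Fin n → ℂ, (∀ x y, a y x = -a x y) ∧ triangleTerm a i j k ≠ 0 ∧
      ∀ x y, a x y ≠ 0 → (x = i ∨ x = j ∨ x = k) ∧ (y = i ∨ y = j ∨ y = k) := by
  let f : Fin n → ℂ := fun x => if x = i ∨ x = j ∨ x = k then 1 else 0
  -- The edges of the triangle get the values `1`, `2`, `-3`, and the row sums become `10`, `5`,
  -- `13`, which are distinct.
  let g : Fin n → ℂ := fun x => if x = j then 1 else if x = k then 3 else 0
  have fi : f i = 1 := by simp [f]
  have fj : f j = 1 := by simp [f]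
  have fk : f k = 1 := by simp [f]
  have gi : g i = 0 := by simp [g, hij, hki.symm]
  have gj : g j = 1 := by simp [g]
  have gk : g k = 3 := by simp [g, hjk.symm]
  let a : Fin n → Fin n → ℂ := fun x y => f x * f y * (g y - g x)
  have hrow : ∀ x, f x = 1 → rowSum a x = g x ^ 2 + (1 - g x) ^ 2 + (3 - g x) ^ 2 := by
    intro x hx
    have : ∀ y, a x y ^ 2 = (if y = i then g x ^ 2 else 0) + (if y = j then (1 - g x) ^ 2 else 0) +
        if y = k then (3 - g x) ^ 2 else 0 := by
      intro y
      by_cases h1 : y = i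
      · subst h1
        simp [a, hx, fi, gi, hij, hki.symm]
      by_cases h2 : y = j
      · subst h2
        simp [a, hx, fj, gj, hij.symm, hjk]
      by_cases h3 : y = k
      · subst h3
        simp [a, hx, fk, gk, hki, hjk.symm]
      simp [a, f, h1, h2, h3]
    simp [rowSum, this, Finset.sum_add_distrib]
  refine ⟨a, fun x y => by simp only [a]; ring, ?_, fun x y hxy => ?_⟩
  · rw [triangleTerm, hrow i fi, hrow j fj, hrow k fk]
    simp only [a, fi, fj, fk, gi, gj, gk]
    norm_num
  · have hx : f x ≠ 0 := fun h => hxy (by simp [a, h])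
    have hy : f y ≠ 0 := fun h => hxy (by simp [a, h])
    simp only [f, ne_eq, ite_eq_right_iff, one_ne_zero, imp_false, not_not] at hx hy
    exact ⟨hx, hy⟩

theorem triangleTerm_rotate {A : Type*} [CommRing A] (a : Fin n → Fin n → A) (i j k : Fin n) :
    triangleTerm a j k i = triangleTerm a i j k := by
  unfold triangleTerm
  ring

theorem triangleTerm_reflect {A : Type*} [CommRing A] {a : Fin n → Fin n → A}
    (ha : ∀ x y, a y x = -a x y) (i j k : Fin n) :
    triangleTerm a k j i = triangleTerm a i j k := by
  unfold triangleTerm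
  rw [ha i j, ha j k, ha k i]
  ring

/-- A nonzero term needs three distinct indices among `i, j, k`, and the term is symmetric in its
indices. -/
theorem triangleTerm_eq_of_support {a : Fin n → Fin n → ℂ} (ha : ∀ x y, a y x = -a x y)
    {i j k : Fin n}
    (hsupp : ∀ x y, a x y ≠ 0 → (x = i ∨ x = j ∨ x = k) ∧ (y = i ∨ y = j ∨ y = k))
    (x y w : Fin n) : triangleTerm a x y w = 0 ∨ triangleTerm a x y w = triangleTerm a i j k := by
  by_cases h : a x y = 0 ∨ a y w = 0 ∨ a w x = 0
  · left
    rcases h with h | h | h <;> simp [triangleTerm, h]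
  right
  push Not at h
  obtain ⟨hxy, hyw, hwx⟩ := h
  have h0 := diag_eq_zero ha
  have nxy : x ≠ y := fun h => hxy (by rw [h, h0])
  have nyw : y ≠ w := fun h => hyw (by rw [h, h0])
  have nwx : w ≠ x := fun h => hwx (by rw [h, h0])
  obtain ⟨hx, hy⟩ := hsupp x y hxy
  have hw := (hsupp y w hyw).2
  have r := triangleTerm_rotate a
  have s := triangleTerm_reflect ha
  rcases hx with rfl | rfl | rfl <;> rcases hy with rfl | rfl | rfl <;>
    rcases hw with rfl | rfl | rfl <;>
    first
    | exact absurd rfl nxy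
    | exact absurd rfl nyw
    | exact absurd rfl nwx
    | rfl
    | exact r _ _ _
    | exact (r _ _ _).symm
    | exact s _ _ _
    | exact (s _ _ _).trans (r _ _ _)
    | exact (s _ _ _).trans (r _ _ _).symm

theorem exists_ne_zero_triangleSum {i j k : Fin n} (hij : i ≠ j) (hjk : j ≠ k) (hki : k ≠ i) :
    ∃ a : Fin n → Fin n → ℂ, (∀ x y, a y x = -a x y) ∧ triangleSum a ≠ 0 ∧
      ∀ ε : Fin n → Fin n → ℤˣ, (∀ i j, ε i j = ε j i) →
        triangleSum (signChange ε a) = ((ε i j * ε j k * ε k i : ℤˣ) : ℤ) * triangleSum a := by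
  classical
  obtain ⟨a, ha, hne, hsupp⟩ := exists_triangle_array hij hjk hki
  have hT := triangleTerm_eq_of_support ha hsupp
  refine ⟨a, ha, ?_, fun ε hε => ?_⟩
  · have h : triangleSum a = ∑ t : Fin n × Fin n × Fin n,
        if triangleTerm a t.1 t.2.1 t.2.2 = 0 then 0 else triangleTerm a i j k := by
      unfold triangleSum
      simp only [← Fintype.sum_prod_type']
      refine Finset.sum_congr rfl fun t _ => ?_
      split_ifs with h
      · exact h
      · exact (hT _ _ _).resolve_left h
    -- The sum is the number of nonzero terms times their common value, and that number is positive.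
    rw [h, Finset.sum_ite, Finset.sum_const_zero, zero_add, Finset.sum_const, nsmul_eq_mul]
    refine mul_ne_zero (Nat.cast_ne_zero.2 (Finset.card_ne_zero_of_mem (a := (i, j, k)) ?_)) hne
    simpa using hne
  · have hεa : ∀ x y, signChange ε a y x = -signChange ε a x y := fun x y => by
      simp only [signChange, hε x y, ha x y]
      ring
    have hT' := triangleTerm_eq_of_support hεa (i := i) (j := j) (k := k) fun x y h =>
      hsupp x y fun h0 => h (by simp [signChange, h0])
    unfold triangleSum
    simp only [Finset.mul_sum]
    refine Finset.sum_congr rfl fun x _ => Finset.sum_congr rfl fun y _ =>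
      Finset.sum_congr rfl fun w _ => ?_
    rcases hT x y w with h | h
    · rw [triangleTerm_signChange, h, mul_zero, mul_zero]
    · rcases hT' x y w with h' | h'
      · rw [triangleTerm_signChange, h] at h'
        rcases Int.units_eq_one_or (ε x y * ε y w * ε w x) with hu | hu <;>
          simp [hu, hne] at h'
      · rw [h', h, triangleTerm_signChange]

/-- Identities between polynomial functions are tested at points: the basis vector of `e` detects
whether `e` belongs to a subset, and an array supported on one triangle detects the sign around it.
-/
theorem isGeneric_c : IsGeneric (c n hd) where
  subset_sums S T h := by
    classical
    have key : ∀ S : Finset (Pairs n), ∀ e,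
        evalAt (basisW₁ n hd e) (∑ e ∈ S, sqFamily (c n hd) e) = if e ∈ S then 1 else 0 := by
      intro S e
      have : ∀ e', evalAt (basisW₁ n hd e) (sqFamily (c n hd) e') = if e' = e then 1 else 0 := by
        intro e'
        rw [sqFamily, map_pow, evalAt_apply, c_apply_of_lt hd e'.2, Module.Basis.repr_self,
          Finsupp.single_apply]
        simp [eq_comm]
      rw [map_sum]
      simp [this]
    ext e
    have := key S e
    rw [h, key T e] at this
    by_cases h1 : e ∈ S <;> by_cases h2 : e ∈ T <;> simp_all
  triangles ε hε h i j k hij hjk hki := by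
    obtain ⟨a, ha, hne, hsum⟩ := exists_ne_zero_triangleSum hij hjk hki
    obtain ⟨v, hv⟩ := exists_c_eq hd a ha
    have hev : (fun i j => evalAt v (c n hd i j)) = a := by
      ext i j
      exact hv i j
    have h' := congrArg (evalAt v) h
    rw [← map_triangleSum, ← map_triangleSum, map_signChange, hev, hsum ε hε] at h'
    rcases Int.units_eq_one_or (ε i j * ε j k * ε k i) with hu | hu
    · exact hu
    · rw [hu] at h'
      have := mul_right_cancel₀ hne (h'.trans (one_mul _).symm)
      norm_num at this

/-- Outside the zero set of a nonzero polynomial function, the coordinates are generic. -/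
theorem exists_isGeneric_evalAt :
    ∃ f : polyFun (W₁ n d), f ≠ 0 ∧ ∀ v, f.1 v ≠ 0 → IsGeneric fun i j => (c n hd i j).1 v := by
  classical
  let D : Finset (Pairs n) → Finset (Pairs n) → polyFun (W₁ n d) := fun S T =>
    ∑ e ∈ S, sqFamily (c n hd) e - ∑ e ∈ T, sqFamily (c n hd) e
  let E : (Fin n → Fin n → ℤˣ) → polyFun (W₁ n d) := fun ε =>
    triangleSum (signChange ε (c n hd)) - triangleSum (c n hd)
  -- Genericity amounts to finitely many non-equalities. Differences that vanish identically are
  -- replaced by `1`, which keeps the product of all of them nonzero.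
  let nz : polyFun (W₁ n d) → polyFun (W₁ n d) := fun f => if f = 0 then 1 else f
  have hnz : ∀ f, nz f ≠ 0 := fun f => by
    by_cases h : f = 0 <;> simp [nz, h]
  have hev : ∀ f v, evalAt v (nz f) ≠ 0 → evalAt v f = 0 → f = 0 := by
    intro f v h h0
    by_contra hf
    simp [nz, hf, h0] at h
  refine ⟨(∏ S, ∏ T, nz (D S T)) * ∏ ε, nz (E ε), mul_ne_zero
    (Finset.prod_ne_zero_iff.2 fun S _ => Finset.prod_ne_zero_iff.2 fun T _ => hnz _)
    (Finset.prod_ne_zero_iff.2 fun ε _ => hnz _), fun v hv => ?_⟩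
  rw [← evalAt_apply, map_mul, map_prod, map_prod, mul_ne_zero_iff, Finset.prod_ne_zero_iff,
    Finset.prod_ne_zero_iff] at hv
  have hgen := isGeneric_c (n := n) hd
  change IsGeneric fun i j => evalAt v (c n hd i j)
  constructor
  · intro S T h
    have hST := hv.1 S (Finset.mem_univ _)
    rw [map_prod, Finset.prod_ne_zero_iff] at hST
    refine hgen.subset_sums S T (sub_eq_zero.1 (hev _ v (hST T (Finset.mem_univ _)) ?_))
    simp only [map_sqFamily, ← map_sum] at h
    rw [map_sub, h, sub_self]
  · intro ε hε h
    rw [← map_signChange, map_triangleSum, map_triangleSum] at h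
    refine hgen.triangles ε hε (sub_eq_zero.1 (hev _ v (hv.2 ε (Finset.mem_univ _)) ?_))
    rw [map_sub, h, sub_self]

/-- Two ring homomorphisms on `ℂ[W₁]` that agree on the generators agree on all the power sums and
on the triangle sum. -/
theorem invariants_eq_of_generators_eq {B : Type*} [CommRing B]
    (φ ψ : polyFun (W₁ n d) →+* B) (h : ∀ f ∈ generators n hd, φ f = ψ f) :
    (∀ l, 1 ≤ l → l ≤ Fintype.card (Pairs n) →
      φ (∑ e, sqFamily (c n hd) e ^ l) = ψ (∑ e, sqFamily (c n hd) e ^ l)) ∧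
    (∀ l, 1 ≤ l → l ≤ n →
      φ (∑ i, rowSum (c n hd) i ^ l) = ψ (∑ i, rowSum (c n hd) i ^ l)) ∧
    φ (triangleSum (c n hd)) = ψ (triangleSum (c n hd)) := by
  have hp : ∀ l, 1 ≤ l → l ≤ Fintype.card (Pairs n) → φ (p n hd l) = ψ (p n hd l) :=
    fun l h1 h2 => h _ (Or.inl (Or.inl ⟨l, h1, card_pairs n ▸ h2, rfl⟩))
  refine ⟨fun l h1 h2 => ?_, fun l h1 h2 => ?_, ?_⟩
  · simpa only [p_eq] using hp l h1 h2
  · rw [← q_eq]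
    rcases h1.eq_or_lt with rfl | h1
    · rw [q_one, map_mul, map_mul, map_ofNat, map_ofNat]
      -- Without pairs, `p 1` is not among the generators, but it is an empty sum.
      rcases Nat.eq_zero_or_pos (Fintype.card (Pairs n)) with h0 | h0
      · have := Fintype.card_eq_zero_iff.1 h0
        simp [p_eq]
      · rw [hp 1 le_rfl h0]
    · exact h _ (Or.inl (Or.inr ⟨l, h1, h2, rfl⟩))
  · rw [← six_mul_z, map_mul, map_mul, map_ofNat, map_ofNat, h _ (Or.inr rfl)]

/-- Two homomorphisms of `ℂ[W₁]` to a field that agree on the generators differ by a signed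
permutation, if one of them is generic. -/
theorem exists_signedPerm_of_generators_eq {B : Type*} [Field B] [CharZero B]
    (φ ψ : polyFun (W₁ n d) →+* B) (hψ : IsGeneric fun i j => ψ (c n hd i j))
    (h : ∀ f ∈ generators n hd, φ f = ψ f) :
    ∃ (τ : Fin n → ℤˣ) (σ : Equiv.Perm (Fin n)),
      ∀ i j, φ (c n hd i j) = (((τ i * τ j : ℤˣ) : ℤ) : B) * ψ (c n hd (σ i) (σ j)) := by
  obtain ⟨hp, hq, hz⟩ := invariants_eq_of_generators_eq hd φ ψ h
  simp only [map_sum, map_pow, ← map_sqFamily, ← map_rowSum, ← map_triangleSum] at hp hq hz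
  exact exists_signedPerm_of_invariants_eq (fun i j => by rw [c_swap, map_neg])
    (fun i j => by rw [c_swap, map_neg]) hψ hp hq hz

theorem separatesGeneralOrbits_generators :
    SeparatesGeneralOrbits (rep n d) (generators n hd) := by
  obtain ⟨f, hf, hgen⟩ := exists_isGeneric_evalAt (n := n) hd
  refine ⟨f, hf, fun v v' hv _ h => ?_⟩
  obtain ⟨τ, σ, hτσ⟩ := exists_signedPerm_of_generators_eq hd (evalAt v') (evalAt v) (hgen v hv)
    fun f hf => (h f hf).symm
  -- By `c_rep`, the coordinates of the image at `σ.symm` of the indices come from those of `v` at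
  -- the indices, whence the inverse.
  obtain ⟨g, hg⟩ := exists_isSignedPerm τ σ.symm
  refine ⟨g, eq_of_c_eq hd fun i j => ?_⟩
  have h1 := c_rep hd hg (σ i) (σ j) v
  simp only [Equiv.symm_apply_apply] at h1
  rw [h1]
  exact (hτσ i j).symm

end Genericity

/-! ### A Galois criterion. -/

section Galois

open Polynomial

/-- If a field extension in characteristic zero is generated by finitely many elements the power
sums of whose squares lie in the base field, then it is Galois, so that an element fixed by all
automorphisms lies in the base field. -/
theorem mem_of_fixed_of_powerSums_sq_mem {k L ι : Type*} [Field k] [Field L] [CharZero L]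
    [Algebra k L] [Fintype ι] (K : IntermediateField k L) (x : ι → L)
    (hx : ∀ l, 1 ≤ l → l ≤ Fintype.card ι → ∑ i, (x i ^ 2) ^ l ∈ K)
    (htop : IntermediateField.adjoin K (Set.range x) = ⊤) (r : L)
    (hr : ∀ φ : Gal(L/K), φ r = r) : r ∈ K := by
  have hlift : (∏ i, (X - C (x i ^ 2))) ∈ lifts (algebraMap K L) := by
    have : (∏ i, (X - C (x i ^ 2))) =
        ((Finset.univ.val.map fun i => x i ^ 2).map fun t => X - C t).prod := by
      rw [Multiset.map_map]
      rfl
    rw [this, Multiset.prod_X_sub_X_eq_sum_esymm]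
    refine sum_mem fun j hj => ?_
    have hj' : j ≤ Fintype.card ι := by simpa [Nat.lt_succ_iff] using hj
    have he : (Finset.univ.val.map fun i => x i ^ 2).esymm j ∈ K :=
      esymm_mem_of_powerSums_mem K.toSubfield.toSubring (fun m a hm ha => by
        have h0 : (m : L) ≠ 0 := Nat.cast_ne_zero.2 hm
        have := K.mul_mem (K.inv_mem (natCast_mem K m)) ha
        rwa [inv_mul_cancel_left₀ h0] at this) _ hx j hj'
    exact (mem_lifts _).2 ⟨(-1) ^ j * (C ⟨_, he⟩ * X ^ _), by
      simp only [Polynomial.map_mul, Polynomial.map_pow, Polynomial.map_neg, Polynomial.map_one,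
        map_C, map_X]
      rfl⟩
  obtain ⟨Q, hQ⟩ := (mem_lifts _).1 hlift
  -- `Q` has the roots `x i ^ 2`, so `Q(X²)` has the roots `x i` and `-x i`; it splits in `L`, and
  -- its roots generate `L` over `K`.
  have hP : (Q.comp (X ^ 2)).map (algebraMap K L) = ∏ i, ((X - C (x i)) * (X + C (x i))) := by
    rw [Polynomial.map_comp, hQ, Polynomial.prod_comp]
    refine Finset.prod_congr rfl fun i _ => ?_
    simp only [sub_comp, X_comp, C_comp, Polynomial.map_pow, map_X]
    rw [C_pow]
    ring
  have hsplit : (Q.comp (X ^ 2)).IsSplittingField K L := by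
    refine isSplittingField_iff_intermediateField.2 ⟨?_, ?_⟩
    · rw [hP]
      exact Splits.prod fun i _ => (Splits.X_sub_C _).mul (Splits.X_add_C _)
    · rw [eq_top_iff, ← htop]
      refine IntermediateField.adjoin.mono _ _ _ ?_
      rintro _ ⟨i, rfl⟩
      rw [mem_rootSet', aeval_def, ← eval_map, hP]
      refine ⟨Finset.prod_ne_zero_iff.2 fun i _ =>
        mul_ne_zero (X_sub_C_ne_zero _) (X_add_C_ne_zero _), ?_⟩
      rw [eval_prod]
      exact Finset.prod_eq_zero (Finset.mem_univ i) (by simp)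
  have : FiniteDimensional K L := IsSplittingField.finiteDimensional L (Q.comp (X ^ 2))
  have : Normal K L := .of_isSplittingField (Q.comp (X ^ 2))
  have : IsGalois K L := ⟨⟩
  obtain ⟨y, rfl⟩ := (IsGalois.mem_range_algebraMap_iff_fixed r).2 hr
  exact y.2

end Galois

/-! ### The field of rational invariants. -/

section Invariants

variable {n d : ℕ} (hd : 2 ≤ d)

theorem polyAct_eq_of_mem_generators (g : signedPermGroup n) {f : polyFun (W₁ n d)}
    (hf : f ∈ generators n hd) : polyAct (rep n d) g f = f := by
  obtain ⟨τ, σ, hg⟩ := g.2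
  let φ : polyFun (W₁ n d) →+* polyFun (W₁ n d) := (polyAct (rep n d) g : _ →+* _)
  have hc : ∀ i j, φ (c n hd i j) =
      (((τ (σ i) * τ (σ j) : ℤˣ) : ℤ) : polyFun (W₁ n d)) * c n hd (σ i) (σ j) :=
    polyAct_c hd hg
  have h0 : ∀ k : ℕ, k ≠ 0 → ∀ a b : polyFun (W₁ n d), (k : polyFun (W₁ n d)) * a = k * b →
      a = b := fun k hk a b h => by
    apply Subtype.ext
    funext v
    have := congrArg (evalAt v) h
    rw [map_mul, map_mul, map_natCast] at this
    exact mul_left_cancel₀ (Nat.cast_ne_zero.2 hk) this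
  change φ f = f
  rcases hf with (⟨l, h1, -, rfl⟩ | ⟨l, -, -, rfl⟩) | rfl
  · rw [p_eq, map_sum]
    simp only [map_pow, ← map_sqFamily]
    exact sum_sqFamily_pow_signedPerm (c_swap hd) (c_self hd)
      (fun a b h => h0 2 two_ne_zero a b (by simpa using h)) (fun i => τ (σ i)) σ hc h1
  · rw [q_eq, map_sum]
    simp only [map_pow, ← map_rowSum]
    refine Fintype.sum_equiv σ _ _ fun i => ?_
    rw [rowSum_signedPerm (fun i => τ (σ i)) σ hc]
  · have h := triangleSum_signedPerm (fun i => τ (σ i)) σ hc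
    rw [map_triangleSum, ← six_mul_z, map_mul, map_ofNat] at h
    exact h0 6 (by norm_num) _ _ (by simpa using h)

theorem ratAct_algebraMap (g : signedPermGroup n) (f : polyFun (W₁ n d)) :
    ratAct (rep n d) g (algebraMap (polyFun (W₁ n d)) _ f) =
      algebraMap (polyFun (W₁ n d)) _ (polyAct (rep n d) g f) :=
  IsFractionRing.algEquivOfAlgEquiv_algebraMap _ _

/-- The coordinate functions, as rational functions. -/
noncomputable def ratCoord (i j : Fin n) : RatFun (W₁ n d) :=
  algebraMap (polyFun (W₁ n d)) _ (c n hd i j)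

/-- The field `ℂ(W₁)` is generated by the coordinate functions. -/
theorem mem_of_ratCoord_mem (M : Subalgebra ℂ (RatFun (W₁ n d)))
    (hinv : ∀ x ∈ M, x⁻¹ ∈ M) (hM : ∀ i j, ratCoord hd i j ∈ M) (x : RatFun (W₁ n d)) :
    x ∈ M := by
  have h : ∀ f : polyFun (W₁ n d), algebraMap (polyFun (W₁ n d)) (RatFun (W₁ n d)) f ∈ M := by
    have : (⊤ : Subalgebra ℂ (polyFun (W₁ n d))) ≤
        M.comap (IsScalarTower.toAlgHom ℂ (polyFun (W₁ n d)) (RatFun (W₁ n d))) := by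
      rw [← adjoin_c_eq_top hd]
      refine Algebra.adjoin_le ?_
      rintro _ ⟨e, rfl⟩
      exact hM e.1 e.2
    exact fun f => this (Algebra.mem_top (x := f))
  obtain ⟨a, b, -, rfl⟩ := IsFractionRing.div_surjective (A := polyFun (W₁ n d)) x
  rw [div_eq_mul_inv]
  exact M.mul_mem (h a) (hinv _ (h b))

theorem algHom_ext_ratCoord {φ ψ : RatFun (W₁ n d) →ₐ[ℂ] RatFun (W₁ n d)}
    (h : ∀ i j, φ (ratCoord hd i j) = ψ (ratCoord hd i j)) : φ = ψ := by
  refine AlgHom.ext fun x => ?_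
  refine mem_of_ratCoord_mem hd (AlgHom.equalizer φ ψ) (fun x hx => ?_) h x
  rw [AlgHom.mem_equalizer] at hx ⊢
  rw [map_inv₀, map_inv₀, hx]

/-- The subfield generated by the invariants. -/
noncomputable def genField : IntermediateField ℂ (RatFun (W₁ n d)) :=
  IntermediateField.adjoin ℂ
    (algebraMap (polyFun (W₁ n d)) (RatFun (W₁ n d)) '' generators n hd)

theorem adjoin_ratCoord_eq_top (K : IntermediateField ℂ (RatFun (W₁ n d))) :
    IntermediateField.adjoin K (Set.range fun e : Pairs n => ratCoord hd e.1.1 e.1.2) = ⊤ := by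
  set M := IntermediateField.adjoin K (Set.range fun e : Pairs n => ratCoord hd e.1.1 e.1.2)
  have hlt : ∀ i j, i < j → ratCoord hd i j ∈ M := fun i j hij =>
    IntermediateField.subset_adjoin _ _ ⟨⟨(i, j), hij⟩, rfl⟩
  refine eq_top_iff.2 fun x _ => ?_
  refine mem_of_ratCoord_mem hd (M.toSubalgebra.restrictScalars ℂ) (fun x hx => M.inv_mem hx)
    (fun i j => ?_) x
  change ratCoord hd i j ∈ M
  rcases lt_trichotomy i j with h | rfl | h
  · exact hlt i j h
  · rw [ratCoord, c_self, map_zero]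
    exact M.zero_mem
  · rw [ratCoord, c_swap hd j i, map_neg]
    exact M.neg_mem (hlt j i h)

theorem sum_ratCoord_sq_pow_mem {l : ℕ} (h1 : 1 ≤ l) (hl : l ≤ Fintype.card (Pairs n)) :
    ∑ e : Pairs n, (ratCoord hd e.1.1 e.1.2 ^ 2) ^ l ∈ genField (n := n) hd := by
  have : ∑ e : Pairs n, (ratCoord hd e.1.1 e.1.2 ^ 2) ^ l =
      algebraMap (polyFun (W₁ n d)) (RatFun (W₁ n d)) (p n hd l) := by
    rw [p_eq, map_sum]
    refine Finset.sum_congr rfl fun e _ => ?_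
    rw [sqFamily, map_pow, map_pow, ratCoord]
  rw [this]
  exact IntermediateField.subset_adjoin _ _
    ⟨_, Or.inl (Or.inl ⟨l, h1, card_pairs n ▸ hl, rfl⟩), rfl⟩

instance : CharZero (RatFun (W₁ n d)) :=
  charZero_of_injective_algebraMap (algebraMap ℂ (RatFun (W₁ n d))).injective

/-- An endomorphism of `ℂ(W₁)` that fixes the generators is the action of a signed permutation. -/
theorem exists_eq_ratAct (φ : RatFun (W₁ n d) →ₐ[ℂ] RatFun (W₁ n d))
    (h : ∀ f ∈ generators n hd, φ (algebraMap (polyFun (W₁ n d)) _ f) =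
      algebraMap (polyFun (W₁ n d)) _ f) :
    ∃ g, ∀ r, φ r = ratAct (rep n d) g r := by
  obtain ⟨τ, σ, hτσ⟩ := exists_signedPerm_of_generators_eq hd
    (φ.toRingHom.comp (algebraMap (polyFun (W₁ n d)) (RatFun (W₁ n d))))
    (algebraMap (polyFun (W₁ n d)) (RatFun (W₁ n d)))
    ((isGeneric_c hd).map _ (IsFractionRing.injective _ _)) h
  -- `polyAct_c` reads the signs at `σ i`, so they are precomposed with `σ.symm`.
  obtain ⟨g, hg⟩ := exists_isSignedPerm (fun i => τ (σ.symm i)) σ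
  have hφ : φ = (ratAct (rep n d) g).toAlgHom := by
    refine algHom_ext_ratCoord hd fun i j => ?_
    have h1 : ratAct (rep n d) g (ratCoord hd i j) =
        (((τ i * τ j : ℤˣ) : ℤ) : RatFun (W₁ n d)) * ratCoord hd (σ i) (σ j) := by
      rw [ratCoord, ratAct_algebraMap, polyAct_c hd hg, map_mul, map_intCast, ratCoord]
      simp only [Equiv.symm_apply_apply]
    exact (hτσ i j).trans h1.symm
  exact ⟨g, fun r => DFunLike.congr_fun hφ r⟩

theorem genField_le_rationalInvariants : genField hd ≤ rationalInvariants (rep n d) := by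
  refine IntermediateField.adjoin_le_iff.2 ?_
  rintro _ ⟨f, hf, rfl⟩ g
  rw [ratAct_algebraMap, polyAct_eq_of_mem_generators hd g hf]

/-- Galois descent: every automorphism over `genField` is the action of a signed permutation and
hence fixes each invariant. -/
theorem rationalInvariants_le_genField : rationalInvariants (rep n d) ≤ genField hd := by
  intro r hr
  refine mem_of_fixed_of_powerSums_sq_mem _ (fun e : Pairs n => ratCoord hd e.1.1 e.1.2)
    (fun l h1 hl => sum_ratCoord_sq_pow_mem hd h1 hl) (adjoin_ratCoord_eq_top hd _) r fun φ => ?_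
  obtain ⟨g, hg⟩ := exists_eq_ratAct hd (φ.toAlgHom.restrictScalars ℂ) fun f hf =>
    φ.commutes ⟨_, IntermediateField.subset_adjoin ℂ _ (Set.mem_image_of_mem _ hf)⟩
  exact (hg r).trans (hr g)

end Invariants

end SignedPermInvariants

theorem mainTheorem2 (n d : ℕ) (hd : 2 ≤ d) :
    IntermediateField.adjoin ℂ
        (algebraMap (SignedPermInvariants.polyFun (SignedPermInvariants.W₁ n d))
          (SignedPermInvariants.RatFun (SignedPermInvariants.W₁ n d)) ''
            SignedPermInvariants.generators n hd) =
      SignedPermInvariants.rationalInvariants (SignedPermInvariants.rep n d) ∧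
    SignedPermInvariants.SeparatesGeneralOrbits (SignedPermInvariants.rep n d)
      (SignedPermInvariants.generators n hd) :=
  ⟨le_antisymm (SignedPermInvariants.genField_le_rationalInvariants hd)
      (SignedPermInvariants.rationalInvariants_le_genField hd),
    SignedPermInvariants.separatesGeneralOrbits_generators hd⟩
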